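/- Let $1\le m\le n$ and let $X\subseteq\mathbb C^n$ be a compact set. Let $\beta$ be the standard Kähler form on $\mathbb C^n$, and let $\Gamma_m$ be the set of real $(1,1)$-forms $\alpha$ with constant coefficients such that $\alpha^k\wedge\beta^{n-k}\ge 0$ for $k=1,\dots,m$. A continuous function $u:U\to\mathbb R$ on an open set $U\subseteq\mathbb C^n$ is called $m$-subharmonic if it is subharmonic and, in the sense of currents, $dd^cu\wedge\alpha_1\wedge\dots\wedge\alpha_{m-1}\wedge\beta^{n-m}\ge 0$ for all $\alpha_1,\dots,\alpha_{m-1}\in\Gamma_m$. Let $\mathcal{SH}_m^o(X)$ be the set of restrictions to $X$ of functions that are continuous and $m$-subharmonic on some open neighbourhood of $X$. For $z\in X$, let $\mathcal J_z^m$ be the set of regular Borel probability measures $\mu$ on $X$ such that $u(z)\le\int_X u\,d\mu$ for all $u\in\mathcal{SH}_m^o(X)$ (the Jensen measures with barycenter $z$). Let $O_X^m=\{z\in X:\mathcal J_z^m=\{\delta_z\}\}$ be the Choquet boundary, let the Šilov boundary $B_X^m$ be the closure of $O_X^m$, and let $\mathcal J_z^{b,m}=\{\mu\in\mathcal J_z^m:\operatorname{supp}\mu\subseteq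 B_X^m\}$. Then $B_X^m$ is the smallest closed set $E\subseteq X$ with the property that for every $z\in X$ there exists $\mu\in\mathcal J_z^m$ with $\operatorname{supp}\mu\subseteq E$; that is, $B_X^m$ has this property and is contained in every closed set $E\subseteq X$ that has it. In particular, $\mathcal J_z^{b,m}$ is nonempty for every $z\in X$. -/

import Mathlib

open MeasureTheory
open scoped ContDiff

noncomputable section

namespace MSH

/-- The space `ℂⁿ` with its Hermitian norm. -/
abbrev Cn (n : ℕ) : Type := EuclideanSpace ℂ (Fin n)

/-- The Wirtinger derivative `∂f/∂z_k`, that is `(∂f/∂x_k - i ∂f/∂y_k) / 2`. -/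
def dz {n : ℕ} (k : Fin n) (f : Cn n → ℂ) (z : Cn n) : ℂ :=
  (fderiv ℝ f z (EuclideanSpace.single k 1)
    - Complex.I * fderiv ℝ f z (EuclideanSpace.single k Complex.I)) / 2

/-- The Wirtinger derivative `∂f/∂z̄_k`, that is `(∂f/∂x_k + i ∂f/∂y_k) / 2`. -/
def dzbar {n : ℕ} (k : Fin n) (f : Cn n → ℂ) (z : Cn n) : ℂ :=
  (fderiv ℝ f z (EuclideanSpace.single k 1)
    + Complex.I * fderiv ℝ f z (EuclideanSpace.single k Complex.I)) / 2

/-- The complex Hessian `(∂²φ/∂z_k∂z̄_l)`; up to a positive factor it is the coefficient matrix of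
the `(1,1)`-form `dd^c φ`. -/
def complexHessian {n : ℕ} (φ : Cn n → ℝ) (z : Cn n) : Matrix (Fin n) (Fin n) ℂ :=
  Matrix.of fun k l => dz k (dzbar l fun w => (φ w : ℂ)) z

/-- The coefficient of the exterior product of `n` forms of bidegree `(1,1)`: if
`α_j = i ∑_{k,l} (A j)_{k l} dz_k ∧ dz̄_l`, then
`α_1 ∧ ⋯ ∧ α_n = wedgeCoeff A • (i dz_1 ∧ dz̄_1) ∧ ⋯ ∧ (i dz_n ∧ dz̄_n)`. -/
def wedgeCoeff {n : ℕ} (A : Fin n → Matrix (Fin n) (Fin n) ℂ) : ℂ :=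
  ∑ σ : Equiv.Perm (Fin n), ∑ τ : Equiv.Perm (Fin n),
    ((Equiv.Perm.sign σ : ℤ) : ℂ) * ((Equiv.Perm.sign τ : ℤ) : ℂ) * ∏ j, A j (σ j) (τ j)

/-- The closed cone `Γ_m` of real `(1,1)`-forms `α` with constant coefficients such that
`α^k ∧ β^(n-k) ≥ 0` for `k = 1, …, m`, where `β` is the standard Kähler form. A real form is given
by its Hermitian coefficient matrix, and `β` by the identity matrix. -/
def Gamma (n m : ℕ) : Set (Matrix (Fin n) (Fin n) ℂ) :=
  {A | A.IsHermitian ∧ ∀ k : ℕ, 1 ≤ k → k ≤ m →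
    0 ≤ (wedgeCoeff fun j : Fin n => if (j : ℕ) < k then A else 1).re}

/-- The coefficient of `dd^c φ ∧ α_1 ∧ ⋯ ∧ α_(m-1) ∧ β^(n-m)`, up to a positive factor; of the
family `A` only the members with index `1, …, m-1` are used. -/
def hessianWedge {n : ℕ} (m : ℕ) (A : Fin n → Matrix (Fin n) (Fin n) ℂ)
    (φ : Cn n → ℝ) (z : Cn n) : ℝ :=
  (wedgeCoeff fun j : Fin n =>
    if (j : ℕ) = 0 then complexHessian φ z else if (j : ℕ) < m then A j else 1).re

/-- `u` is a (real-valued) continuous `m`-subharmonic function on the open set `U`: it is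
continuous and subharmonic on `U`, and the current
`dd^c u ∧ α_1 ∧ ⋯ ∧ α_(m-1) ∧ β^(n-m)` is nonnegative on `U` for all `α_1, …, α_(m-1) ∈ Γ_m`. -/
structure IsContMSubharmonicOn {n : ℕ} (m : ℕ) (u : Cn n → ℝ) (U : Set (Cn n)) : Prop where
  continuousOn : ContinuousOn u U
  subharmonic : ∀ (z : Cn n) (r : ℝ), 0 < r → Metric.closedBall z r ⊆ U →
    u z ≤ ⨍ w in Metric.closedBall z r, u w
  nonneg_current : ∀ A : Fin n → Matrix (Fin n) (Fin n) ℂ, (∀ j, A j ∈ Gamma n m) →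
    ∀ φ : Cn n → ℝ, ContDiff ℝ ∞ φ → HasCompactSupport φ → tsupport φ ⊆ U → (∀ z, 0 ≤ φ z) →
      0 ≤ ∫ z, u z * hessianWedge m A φ z

/-- The class `SH_m^o(X)` of restrictions to `X` of functions that are continuous and
`m`-subharmonic on some open neighbourhood of `X`. -/
def SHo {n : ℕ} (m : ℕ) (X : Set (Cn n)) : Set (X → ℝ) :=
  {f | ∃ (U : Set (Cn n)) (u : Cn n → ℝ), IsOpen U ∧ X ⊆ U ∧ IsContMSubharmonicOn m u U ∧
    ∀ x : X, f x = u x}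

/-- The set `J_z^m(X)` of Jensen measures on `X` with barycenter `z` with respect to
`SH_m^o(X)`. -/
def jensenMeasures {n : ℕ} (m : ℕ) (X : Set (Cn n)) (z : X) : Set (Measure X) :=
  {μ | IsProbabilityMeasure μ ∧ μ.Regular ∧ ∀ f ∈ SHo m X, f z ≤ ∫ x, f x ∂μ}

/-- The Choquet boundary `O_X^m`. -/
def choquetBoundary {n : ℕ} (m : ℕ) (X : Set (Cn n)) : Set X :=
  {z | jensenMeasures m X z = {Measure.dirac z}}

/-- The Šilov boundary `B_X^m`. As `X` is compact, the closure in `X` is the closure in `ℂⁿ`. -/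
def silovBoundary {n : ℕ} (m : ℕ) (X : Set (Cn n)) : Set X :=
  closure (choquetBoundary m X)

/-- The set `J_z^{b,m}` of Jensen measures with barycenter `z` whose support is contained in the
Šilov boundary. -/
def boundaryJensenMeasures {n : ℕ} (m : ℕ) (X : Set (Cn n)) (z : X) : Set (Measure X) :=
  {μ | μ ∈ jensenMeasures m X z ∧ μ.support ⊆ silovBoundary m X}

end MSH

end

/-! The statement is Choquet theory for a convex cone `S` of continuous functions on a compact
metric space that contains 0 and separates points. The subset of a stable set where some `f ∈ S` is
maximal is again stable. A minimal stable set is therefore a single point, and that point is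
extreme. Hence each `f ∈ S` attains its maximum at an extreme point (`exists_extremePoint_ge`).
Hahn-Banach and Riesz then turn this maximum principle into representing measures on the closure of
the extreme points (`exists_representing_support_subset`). That closure is least because an extreme
point is represented only by its Dirac measure.

What remains is to check that `SHo m X` is such a cone. Real-linear functions are annihilated by
second derivatives, so they belong to it, and they separate points. -/

namespace MSH

/-! ### Choquet theory for cones of continuous functions on a compact metric space -/

section Choquet

variable {Y : Type*} [MetricSpace Y] [CompactSpace Y] [MeasurableSpace Y]

/-- Regular Borel probability measures `μ` with `f z ≤ ∫ f dμ` for all `f` in the family `S`. -/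
def representing (S : Set (Y → ℝ)) (z : Y) : Set (Measure Y) :=
  {μ | IsProbabilityMeasure μ ∧ μ.Regular ∧ ∀ f ∈ S, f z ≤ ∫ x, f x ∂μ}

/-- The points that are represented only by their Dirac measure. -/
def extremePoints (S : Set (Y → ℝ)) : Set Y :=
  {z | representing S z = {Measure.dirac z}}

/-- A closed set is stable if it carries every measure that represents one of its points. -/
structure IsStable (S : Set (Y → ℝ)) (F : Set Y) : Prop where
  isClosed : IsClosed F
  support_subset : ∀ z ∈ F, ∀ μ ∈ representing S z, μ.support ⊆ F

/-- Zorn's lemma: stability passes to intersections, and compactness keeps the intersection of a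
chain nonempty. -/
theorem exists_minimal_isStable {S : Set (Y → ℝ)} {F : Set Y} (hF : IsStable S F)
    (hne : F.Nonempty) : ∃ G ⊆ F, Minimal (fun G => IsStable S G ∧ G.Nonempty) G := by
  refine zorn_superset_nonempty {G | IsStable S G ∧ G.Nonempty} ?_ F ⟨hF, hne⟩
  intro c hc hchain hcne
  have : Nonempty c := hcne.to_subtype
  refine ⟨⋂₀ c, ⟨⟨isClosed_sInter fun G hG => (hc hG).1.isClosed, fun z hz μ hμ =>
    Set.subset_sInter fun G hG => (hc hG).1.support_subset z (hz G hG) μ hμ⟩, ?_⟩,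
    fun G hG => Set.sInter_subset_of_mem hG⟩
  exact IsCompact.nonempty_sInter_of_directed_nonempty_isCompact_isClosed (fun a ha b hb =>
    (hchain.total ha hb).elim (fun h => ⟨a, ha, subset_rfl, h⟩) fun h => ⟨b, hb, h, subset_rfl⟩)
    (fun G hG => (hc hG).2) (fun G hG => (hc hG).1.isClosed.isCompact)
    (fun G hG => (hc hG).1.isClosed)

variable [BorelSpace Y]

theorem dirac_mem_representing (S : Set (Y → ℝ)) (z : Y) :
    Measure.dirac z ∈ representing S z :=
  ⟨inferInstance, inferInstance, fun f _ => by simp⟩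

/-- The subset of a stable set on which a continuous member of the family is maximal is stable. -/
theorem IsStable.inter_max {S : Set (Y → ℝ)} {F : Set Y} (hF : IsStable S F) {f : Y → ℝ}
    (hf : f ∈ S) (hfc : Continuous f) {M : ℝ} (hM : ∀ y ∈ F, f y ≤ M) :
    IsStable S (F ∩ {y | f y = M}) := by
  have hcl : IsClosed (F ∩ {y | f y = M}) :=
    hF.isClosed.inter (isClosed_eq hfc continuous_const)
  refine ⟨hcl, fun z hz μ hμ => ?_⟩
  obtain ⟨hp, hr, hle⟩ := hμ
  have hFae : ∀ᵐ y ∂μ, y ∈ F := by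
    filter_upwards [μ.support_mem_ae] with y hy
    exact hF.support_subset z hz.1 μ ⟨hp, hr, hle⟩ hy
  have hfi : Integrable f μ :=
    hfc.integrable_of_hasCompactSupport (HasCompactSupport.of_compactSpace f)
  have hnn : 0 ≤ᵐ[μ] fun y => M - f y := by
    filter_upwards [hFae] with y hy
    simpa using hM y hy
  -- Since `f z = M`, the representing inequality gives `∫ f dμ ≥ M`, while `f ≤ M` almost
  -- everywhere. So `f = M` almost everywhere.
  have hint : ∫ y, (M - f y) ∂μ = 0 := by
    refine le_antisymm ?_ (integral_nonneg_of_ae hnn)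
    rw [integral_sub (integrable_const _) hfi]
    have h1 := hle f hf
    have h2 : f z = M := hz.2
    simp only [integral_const, probReal_univ, one_smul]
    linarith
  have hzero := (integral_eq_zero_iff_of_nonneg_ae hnn ((integrable_const _).sub hfi)).1 hint
  refine Measure.support_subset_of_isClosed hcl ?_
  filter_upwards [hFae, hzero] with y hy h0
  exact ⟨hy, by simp only [Pi.zero_apply] at h0; simp only [Set.mem_ofPred_eq]; linarith⟩

/-- Minimality forces every `f ∈ S` to be constant on a minimal stable set, so separation leaves one
point. Stability of that singleton makes every representing measure Dirac. -/
theorem exists_mem_extremePoints_of_isStable {S : Set (Y → ℝ)} (hS : ∀ f ∈ S, Continuous f)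
    (hsep : ∀ x y : Y, x ≠ y → ∃ f ∈ S, f x ≠ f y) {F : Set Y} (hF : IsStable S F)
    (hne : F.Nonempty) : ∃ z ∈ F, z ∈ extremePoints S := by
  obtain ⟨G, hGF, ⟨hG, hGne⟩, hmin⟩ := exists_minimal_isStable hF hne
  have hconst : ∀ f ∈ S, ∃ M, ∀ y ∈ G, f y = M := by
    intro f hf
    obtain ⟨y₀, hy₀, hmax⟩ := hG.isClosed.isCompact.exists_isMaxOn hGne (hS f hf).continuousOn
    refine ⟨f y₀, fun y hy => ?_⟩
    exact (hmin ⟨hG.inter_max hf (hS f hf) (fun y hy => hmax hy), y₀, hy₀, rfl⟩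
      Set.inter_subset_left hy).2
  obtain ⟨z, hz⟩ := hGne
  have hGz : G = {z} := by
    refine Set.eq_singleton_iff_unique_mem.2 ⟨hz, fun y hy => ?_⟩
    by_contra hyz
    obtain ⟨f, hf, hfne⟩ := hsep y z hyz
    obtain ⟨M, hM⟩ := hconst f hf
    exact hfne ((hM y hy).trans (hM z hz).symm)
  refine ⟨z, hGF hz, Set.eq_singleton_iff_unique_mem.2 ⟨dirac_mem_representing S z, ?_⟩⟩
  intro μ hμ
  have hsupp := hG.support_subset z hz μ hμ
  have : IsProbabilityMeasure μ := hμ.1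
  have hae : ∀ᵐ y ∂μ, y = z := by
    filter_upwards [μ.support_mem_ae] with y hy
    simpa [hGz] using hsupp hy
  ext s hs
  rw [Measure.dirac_apply' _ hs]
  by_cases hzs : z ∈ s
  · rw [Set.indicator_of_mem hzs, Pi.one_apply, ← mem_ae_iff_prob_eq_one hs]
    filter_upwards [hae] with y hy
    rwa [hy]
  · rw [Set.indicator_of_notMem hzs, measure_eq_zero_iff_ae_notMem]
    filter_upwards [hae] with y hy
    rwa [hy]

/-- Every member of the family attains its maximum on the set of extreme points. -/
theorem exists_extremePoint_ge {S : Set (Y → ℝ)} (hS : ∀ f ∈ S, Continuous f)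
    (hsep : ∀ x y : Y, x ≠ y → ∃ f ∈ S, f x ≠ f y) {f : Y → ℝ} (hf : f ∈ S) (z : Y) :
    ∃ y ∈ extremePoints S, f z ≤ f y := by
  obtain ⟨y₀, -, hmax⟩ :=
    isCompact_univ.exists_isMaxOn ⟨z, Set.mem_univ z⟩ (hS f hf).continuousOn
  have huniv : IsStable S (Set.univ : Set Y) := ⟨isClosed_univ, fun _ _ _ _ => Set.subset_univ _⟩
  obtain ⟨y, hy, hext⟩ := exists_mem_extremePoints_of_isStable hS hsep
    (huniv.inter_max hf (hS f hf) fun y hy => hmax hy) ⟨y₀, Set.mem_univ _, rfl⟩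
  exact ⟨y, hext, (hmax (Set.mem_univ z)).trans_eq hy.2.symm⟩

/-- A functional on `C(Y)` that is negative on the functions negative on the nonempty set `B` is,
up to a positive factor, integration against a probability measure on the closed set `B`. -/
theorem exists_probability_of_neg {B : Set Y} (hB : IsClosed B) (hne : B.Nonempty)
    (Λ : C(Y, ℝ) →ₗ[ℝ] ℝ) (hΛ : ∀ g : C(Y, ℝ), (∀ y ∈ B, g y < 0) → Λ g < 0) :
    ∃ μ : Measure Y, IsProbabilityMeasure μ ∧ μ.Regular ∧ μ.support ⊆ B ∧
      ∃ c : ℝ, 0 < c ∧ ∀ g : C(Y, ℝ), Λ g = c * ∫ y, g y ∂μ := by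
  have h1 : 0 < Λ 1 := by
    have := hΛ (-1) (by simp)
    rw [map_neg] at this
    linarith
  have hnonneg : ∀ g : C(Y, ℝ), (∀ y ∈ B, 0 ≤ g y) → 0 ≤ Λ g := by
    intro g hg
    by_contra! hlt
    -- The negative constant makes the function strictly negative on `B`, yet `Λ` sends it to `-Λ g
    -- / 2 > 0`.
    have := hΛ (-g + (Λ g / (2 * Λ 1)) • 1) (fun y hy => by
      have h2 : Λ g / (2 * Λ 1) < 0 := div_neg_of_neg_of_pos hlt (by positivity)
      have := hg y hy
      simp
      linarith)
    rw [map_add, map_neg, map_smul, smul_eq_mul] at this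
    have h3 : Λ g / (2 * Λ 1) * Λ 1 = Λ g / 2 := by field_simp
    linarith
  let Λ' : CompactlySupportedContinuousMap Y ℝ →ₗ[ℝ] ℝ :=
    { toFun := fun g => (Λ 1)⁻¹ * Λ g.toContinuousMap
      map_add' := fun f g => by
        have : (f + g).toContinuousMap = f.toContinuousMap + g.toContinuousMap := rfl
        rw [this, map_add, mul_add]
      map_smul' := fun a g => by
        have : (a • g).toContinuousMap = a • g.toContinuousMap := rfl
        rw [this, map_smul, smul_eq_mul, smul_eq_mul, RingHom.id_apply]
        ring }
  let L : CompactlySupportedContinuousMap Y ℝ →ₚ[ℝ] ℝ := PositiveLinearMap.mk₀ Λ' fun g hg =>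
    mul_nonneg (inv_nonneg.2 h1.le) (hnonneg _ fun y _ => hg y)
  have hint : ∀ g : C(Y, ℝ), ∫ y, g y ∂(RealRMK.rieszMeasure L) = (Λ 1)⁻¹ * Λ g := fun g =>
    RealRMK.integral_rieszMeasure L
      (CompactlySupportedContinuousMap.continuousMapEquiv g)
  have hone : ∫ y, (1 : C(Y, ℝ)) y ∂(RealRMK.rieszMeasure L) = 1 := by
    rw [hint, inv_mul_cancel₀ h1.ne']
  have hprob : IsProbabilityMeasure (RealRMK.rieszMeasure L) := by
    simp only [ContinuousMap.one_apply, integral_const, smul_eq_mul, mul_one] at hone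
    exact ⟨(ENNReal.toReal_eq_one_iff _).1 hone⟩
  refine ⟨RealRMK.rieszMeasure L, hprob, inferInstance, ?_, Λ 1, h1, fun g => ?_⟩
  -- Both `d` and `-d` are nonnegative on `B`, so the distance to `B` has integral zero and the
  -- measure lives on `B`.
  · let d : C(Y, ℝ) := ⟨fun y => Metric.infDist y B, Metric.continuous_infDist_pt B⟩
    have hd0 : ∀ y ∈ B, d y = 0 := fun y hy => Metric.infDist_zero_of_mem hy
    have hΛd : Λ d = 0 := by
      refine le_antisymm ?_ (hnonneg d fun y hy => (hd0 y hy).ge)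
      have := hnonneg (-d) fun y hy => by simp [hd0 y hy]
      rw [map_neg] at this
      linarith
    have hd : ∫ y, d y ∂(RealRMK.rieszMeasure L) = 0 := by rw [hint, hΛd, mul_zero]
    have hzero := (integral_eq_zero_iff_of_nonneg (fun y => Metric.infDist_nonneg)
      (d.continuous.integrable_of_hasCompactSupport
        (HasCompactSupport.of_compactSpace _))).1 hd
    refine Measure.support_subset_of_isClosed hB ?_
    filter_upwards [hzero] with y hy
    exact (hB.mem_iff_infDist_zero hne).2 hy
  · rw [hint, mul_inv_cancel_left₀ h1.ne']

/-- If every member of a convex cone of continuous functions is bounded at `z` by its values on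
the closed set `B`, then `z` is represented by a measure on `B`. -/
theorem exists_representing_support_subset {S : Set (Y → ℝ)} (hS : ∀ f ∈ S, Continuous f)
    (h0 : (0 : Y → ℝ) ∈ S) (hadd : ∀ f ∈ S, ∀ g ∈ S, f + g ∈ S)
    (hsmul : ∀ c : ℝ, 0 < c → ∀ f ∈ S, c • f ∈ S) {B : Set Y} (hB : IsClosed B) (z : Y)
    (hmax : ∀ f ∈ S, ∃ y ∈ B, f z ≤ f y) :
    ∃ μ ∈ representing S z, μ.support ⊆ B := by
  obtain ⟨b, hb, -⟩ := hmax 0 h0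
  let N : Set C(Y, ℝ) := {g | ∀ y ∈ B, g y < 0}
  let K : Set C(Y, ℝ) := {g | ∃ f ∈ S, ∀ y, g y = f y - f z}
  have hNo : IsOpen N := by
    have : N = {g : C(Y, ℝ) | Set.MapsTo g B (Set.Iio 0)} := rfl
    rw [this]
    exact ContinuousMap.isOpen_setOfPred_mapsTo hB.isCompact isOpen_Iio
  have hNc : Convex ℝ N := by
    intro f hf g hg a c ha hc hac y hy
    have h1 := hf y hy
    have h2 := hg y hy
    simp only [ContinuousMap.add_apply, ContinuousMap.smul_apply, smul_eq_mul]
    rcases ha.eq_or_lt with rfl | ha'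
    · have : c = 1 := by linarith
      subst this
      linarith
    · nlinarith [mul_neg_of_pos_of_neg ha' h1, mul_nonpos_of_nonneg_of_nonpos hc h2.le]
  have hKsmul : ∀ c : ℝ, 0 < c → ∀ g ∈ K, c • g ∈ K := by
    rintro c hc g ⟨f, hf, hg⟩
    refine ⟨c • f, hsmul c hc f hf, fun y => ?_⟩
    simp [hg, mul_sub]
  have hKadd : ∀ g ∈ K, ∀ h ∈ K, g + h ∈ K := by
    rintro g ⟨f, hf, hg⟩ h ⟨f', hf', hh⟩
    refine ⟨f + f', hadd f hf f' hf', fun y => ?_⟩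
    simp [hg, hh]
    ring
  have hKc : Convex ℝ K := by
    intro f hf g hg a c ha hc hac
    rcases ha.eq_or_lt with rfl | ha'
    · obtain rfl : c = 1 := by linarith
      simpa using hg
    rcases hc.eq_or_lt with rfl | hc'
    · obtain rfl : a = 1 := by linarith
      simpa using hf
    exact hKadd _ (hKsmul a ha' f hf) _ (hKsmul c hc' g hg)
  have hK0 : (0 : C(Y, ℝ)) ∈ K := ⟨0, h0, by simp⟩
  have hdisj : Disjoint N K := by
    rw [Set.disjoint_left]
    rintro g hgN ⟨f, hf, hg⟩
    obtain ⟨y, hy, hle⟩ := hmax f hf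
    have := hgN y hy
    rw [hg] at this
    linarith
  -- Since `0 ∈ K`, the separating level satisfies `r ≤ 0`; thus `Λ` is negative on `N`, and the
  -- cone property makes it nonnegative on `K`.
  obtain ⟨Λ, r, hΛN, hΛK⟩ := geometric_hahn_banach_open hNc hNo hKc hdisj
  have hr : r ≤ 0 := by simpa using hΛK 0 hK0
  obtain ⟨μ, hp, hreg, hsupp, c, hc, hrep⟩ := exists_probability_of_neg hB ⟨b, hb⟩
    (Λ : C(Y, ℝ) →ₗ[ℝ] ℝ) fun g hg => (hΛN g hg).trans_le hr
  refine ⟨μ, ⟨hp, hreg, fun f hf => ?_⟩, hsupp⟩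
  let g : C(Y, ℝ) := ⟨fun y => f y - f z, (hS f hf).sub continuous_const⟩
  have hgK : g ∈ K := ⟨f, hf, fun _ => rfl⟩
  have hΛg : 0 ≤ Λ g := by
    by_contra! hlt
    -- Scaling `g` by this factor gives a member of `K` with `Λ`-value `r - 1 < r`.
    have ht : 0 < (r - 1) / Λ g := div_pos_of_neg_of_neg (by linarith) hlt
    have := hΛK _ (hKsmul _ ht g hgK)
    rw [map_smul, smul_eq_mul, div_mul_cancel₀ _ hlt.ne] at this
    linarith
  have hnn : 0 ≤ ∫ y, g y ∂μ := by
    have := hrep g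
    rw [ContinuousLinearMap.coe_coe] at this
    exact nonneg_of_mul_nonneg_right (this ▸ hΛg) hc
  have hfi : Integrable f μ :=
    (hS f hf).integrable_of_hasCompactSupport (HasCompactSupport.of_compactSpace f)
  have : ∫ y, g y ∂μ = ∫ y, f y ∂μ - f z := by
    change ∫ y, (f y - f z) ∂μ = _
    rw [integral_sub hfi (integrable_const _)]
    simp
  linarith

/-- The closure of the set of extreme points is the least closed set that carries a representing
measure of every point. -/
theorem isLeast_closure_extremePoints {S : Set (Y → ℝ)} (hS : ∀ f ∈ S, Continuous f)
    (h0 : (0 : Y → ℝ) ∈ S) (hadd : ∀ f ∈ S, ∀ g ∈ S, f + g ∈ S)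
    (hsmul : ∀ c : ℝ, 0 < c → ∀ f ∈ S, c • f ∈ S)
    (hsep : ∀ x y : Y, x ≠ y → ∃ f ∈ S, f x ≠ f y) :
    IsLeast {E : Set Y | IsClosed E ∧ ∀ z, ∃ μ ∈ representing S z, μ.support ⊆ E}
      (closure (extremePoints S)) := by
  refine ⟨⟨isClosed_closure, fun z => ?_⟩, ?_⟩
  · refine exists_representing_support_subset hS h0 hadd hsmul isClosed_closure z fun f hf => ?_
    obtain ⟨y, hy, hle⟩ := exists_extremePoint_ge hS hsep hf z
    exact ⟨y, subset_closure hy, hle⟩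
  · rintro E ⟨hE, hEr⟩
    refine closure_minimal (fun z hz => ?_) hE
    obtain ⟨μ, hμ, hsupp⟩ := hEr z
    obtain rfl : μ = Measure.dirac z := by
      have hz' : representing S z = {Measure.dirac z} := hz
      simpa [hz'] using hμ
    refine hsupp ((Measure.mem_support_iff_forall z).2 fun U hU => ?_)
    rw [Measure.dirac_apply_of_mem (mem_of_mem_nhds hU)]
    exact one_pos

end Choquet

/-! ### Continuous `m`-subharmonic functions form a cone that separates points -/

section Hessian

variable {n : ℕ}

theorem contDiff_dz {f : Cn n → ℂ} (hf : ContDiff ℝ ∞ f) (k : Fin n) : ContDiff ℝ ∞ (dz k f) := by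
  have h := hf.fderiv_right (m := ∞) (by simp)
  exact ((h.clm_apply contDiff_const).sub
    (contDiff_const.mul (h.clm_apply contDiff_const))).div_const 2

theorem contDiff_dzbar {f : Cn n → ℂ} (hf : ContDiff ℝ ∞ f) (k : Fin n) :
    ContDiff ℝ ∞ (dzbar k f) := by
  have h := hf.fderiv_right (m := ∞) (by simp)
  exact ((h.clm_apply contDiff_const).add
    (contDiff_const.mul (h.clm_apply contDiff_const))).div_const 2

theorem tsupport_dz_subset (f : Cn n → ℂ) (k : Fin n) : tsupport (dz k f) ⊆ tsupport f := by
  refine (closure_mono fun z hz => ?_).trans (tsupport_fderiv_subset ℝ)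
  contrapose! hz
  simp only [Function.mem_support, not_not] at hz
  simp [dz, hz]

theorem tsupport_dzbar_subset (f : Cn n → ℂ) (k : Fin n) : tsupport (dzbar k f) ⊆ tsupport f := by
  refine (closure_mono fun z hz => ?_).trans (tsupport_fderiv_subset ℝ)
  contrapose! hz
  simp only [Function.mem_support, not_not] at hz
  simp [dzbar, hz]

theorem tsupport_complexHessian_subset (φ : Cn n → ℝ) (k l : Fin n) :
    tsupport (fun z => complexHessian φ z k l) ⊆ tsupport φ := by
  refine ((tsupport_dz_subset _ k).trans (tsupport_dzbar_subset _ l)).trans ?_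
  refine closure_mono fun z hz => ?_
  simpa using hz

theorem contDiff_complexHessian {φ : Cn n → ℝ} (hφ : ContDiff ℝ ∞ φ) (k l : Fin n) :
    ContDiff ℝ ∞ fun z => complexHessian φ z k l :=
  contDiff_dz (contDiff_dzbar (Complex.ofRealCLM.contDiff.comp hφ) l) k

/-- The Hessian wedge product is a fixed linear expression in the entries of the Hessian. -/
theorem exists_hessianWedge_eq (hn : 0 < n) (m : ℕ) (A : Fin n → Matrix (Fin n) (Fin n) ℂ) :
    ∃ c : Equiv.Perm (Fin n) → Equiv.Perm (Fin n) → ℂ, ∀ φ z,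
      hessianWedge m A φ z =
        (∑ σ, ∑ τ, c σ τ * complexHessian φ z (σ ⟨0, hn⟩) (τ ⟨0, hn⟩)).re := by
  refine ⟨fun σ τ => ((Equiv.Perm.sign σ : ℤ) : ℂ) * ((Equiv.Perm.sign τ : ℤ) : ℂ) *
    ∏ j ∈ Finset.univ.erase (⟨0, hn⟩ : Fin n),
      (if (j : ℕ) < m then A j else 1) (σ j) (τ j), fun φ z => ?_⟩
  unfold hessianWedge wedgeCoeff
  congr 1
  refine Finset.sum_congr rfl fun σ _ => Finset.sum_congr rfl fun τ _ => ?_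
  have hprod : ∏ j ∈ Finset.univ.erase (⟨0, hn⟩ : Fin n),
      (if (j : ℕ) = 0 then complexHessian φ z else if (j : ℕ) < m then A j else 1) (σ j) (τ j) =
      ∏ j ∈ Finset.univ.erase (⟨0, hn⟩ : Fin n),
        (if (j : ℕ) < m then A j else 1) (σ j) (τ j) := by
    refine Finset.prod_congr rfl fun j hj => ?_
    rw [if_neg fun h => (Finset.mem_erase.1 hj).1 (Fin.ext h)]
  rw [← Finset.mul_prod_erase Finset.univ _ (Finset.mem_univ (⟨0, hn⟩ : Fin n)), hprod]
  change _ * (complexHessian φ z (σ ⟨0, hn⟩) (τ ⟨0, hn⟩) * _) = _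
  ring

theorem continuous_hessianWedge (hn : 0 < n) (m : ℕ) (A : Fin n → Matrix (Fin n) (Fin n) ℂ)
    {φ : Cn n → ℝ} (hφ : ContDiff ℝ ∞ φ) : Continuous (hessianWedge m A φ) := by
  obtain ⟨c, hc⟩ := exists_hessianWedge_eq hn m A
  simp only [funext (hc φ)]
  exact Complex.continuous_re.comp <| continuous_finsetSum _ fun σ _ =>
    continuous_finsetSum _ fun τ _ =>
      continuous_const.mul (contDiff_complexHessian hφ _ _).continuous

theorem tsupport_hessianWedge_subset (hn : 0 < n) (m : ℕ)
    (A : Fin n → Matrix (Fin n) (Fin n) ℂ) (φ : Cn n → ℝ) :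
    tsupport (hessianWedge m A φ) ⊆ tsupport φ := by
  obtain ⟨c, hc⟩ := exists_hessianWedge_eq hn m A
  refine closure_minimal (fun z hz => ?_) (isClosed_tsupport φ)
  contrapose! hz
  have h0 : ∀ k l, complexHessian φ z k l = 0 := fun k l =>
    image_eq_zero_of_notMem_tsupport (f := fun z => complexHessian φ z k l) fun h =>
      hz (tsupport_complexHessian_subset φ k l h)
  simp [hc, h0]

/-- Although `u` is controlled only on `U`, the product is continuous everywhere because the other
factor is supported in `U`. -/
theorem integrable_mul_hessianWedge (hn : 0 < n) (m : ℕ)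
    (A : Fin n → Matrix (Fin n) (Fin n) ℂ) {U : Set (Cn n)} (hU : IsOpen U) {u : Cn n → ℝ}
    (hu : ContinuousOn u U) {φ : Cn n → ℝ} (hφ : ContDiff ℝ ∞ φ) (hc : HasCompactSupport φ)
    (hsupp : tsupport φ ⊆ U) : Integrable fun z => u z * hessianWedge m A φ z := by
  have hsub := tsupport_hessianWedge_subset hn m A φ
  have hcs : HasCompactSupport (hessianWedge m A φ) :=
    hc.of_isClosed_subset (isClosed_tsupport _) hsub
  refine Continuous.integrable_of_hasCompactSupport ?_ hcs.mul_left
  refine continuous_of_tsupport fun z hz => ?_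
  have hzU : z ∈ U := hsupp (hsub (tsupport_mul_subset_right hz))
  exact (hu.continuousAt (hU.mem_nhds hzU)).mul (continuous_hessianWedge hn m A hφ).continuousAt

theorem IsContMSubharmonicOn.add (hn : 0 < n) {m : ℕ} {U : Set (Cn n)} (hU : IsOpen U)
    {u v : Cn n → ℝ} (hu : IsContMSubharmonicOn m u U) (hv : IsContMSubharmonicOn m v U) :
    IsContMSubharmonicOn m (u + v) U where
  continuousOn := hu.continuousOn.add hv.continuousOn
  subharmonic z r hr hzr := by
    have hi : ∀ w : Cn n → ℝ, ContinuousOn w U → IntegrableOn w (Metric.closedBall z r) :=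
      fun w hw => (hw.mono hzr).integrableOn_compact (isCompact_closedBall z r)
    have h1 := hu.subharmonic z r hr hzr
    have h2 := hv.subharmonic z r hr hzr
    rw [setAverage_eq, smul_eq_mul] at h1 h2 ⊢
    have : ∫ w in Metric.closedBall z r, (u + v) w =
        (∫ w in Metric.closedBall z r, u w) + ∫ w in Metric.closedBall z r, v w :=
      integral_add (hi u hu.continuousOn) (hi v hv.continuousOn)
    rw [this, mul_add]
    exact add_le_add h1 h2
  nonneg_current A hA φ hφ hc hsupp hnn := by
    have h1 := hu.nonneg_current A hA φ hφ hc hsupp hnn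
    have h2 := hv.nonneg_current A hA φ hφ hc hsupp hnn
    simp only [Pi.add_apply, add_mul]
    rw [integral_add (integrable_mul_hessianWedge hn m A hU hu.continuousOn hφ hc hsupp)
      (integrable_mul_hessianWedge hn m A hU hv.continuousOn hφ hc hsupp)]
    exact add_nonneg h1 h2

theorem IsContMSubharmonicOn.smul {m : ℕ} {U : Set (Cn n)} {u : Cn n → ℝ}
    (hu : IsContMSubharmonicOn m u U) {c : ℝ} (hc : 0 ≤ c) :
    IsContMSubharmonicOn m (c • u) U where
  continuousOn := hu.continuousOn.const_smul c
  subharmonic z r hr hzr := by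
    have h1 := mul_le_mul_of_nonneg_left (hu.subharmonic z r hr hzr) hc
    simp only [setAverage_eq, smul_eq_mul, Pi.smul_apply, integral_const_mul] at h1 ⊢
    linarith
  nonneg_current A hA φ hφ hcs hsupp hnn := by
    simp only [Pi.smul_apply, smul_eq_mul, mul_assoc, integral_const_mul]
    exact mul_nonneg hc (hu.nonneg_current A hA φ hφ hcs hsupp hnn)

theorem IsContMSubharmonicOn.mono {m : ℕ} {U V : Set (Cn n)} {u : Cn n → ℝ}
    (hu : IsContMSubharmonicOn m u U) (hVU : V ⊆ U) : IsContMSubharmonicOn m u V where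
  continuousOn := hu.continuousOn.mono hVU
  subharmonic z r hr hzr := hu.subharmonic z r hr (hzr.trans hVU)
  nonneg_current A hA φ hφ hc hsupp hnn :=
    hu.nonneg_current A hA φ hφ hc (hsupp.trans hVU) hnn

/-- Integration by parts against a real-linear functional. -/
theorem integral_clm_mul_fderiv (ℓ : Cn n →L[ℝ] ℂ) {g : Cn n → ℂ} (hg : ContDiff ℝ ∞ g)
    (hc : HasCompactSupport g) (v : Cn n) :
    ∫ z, ℓ z * fderiv ℝ g z v = -(ℓ v * ∫ z, g z) := by
  have hg' : Continuous fun z => fderiv ℝ g z v :=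
    (hg.continuous_fderiv (by simp)).clm_apply continuous_const
  rw [integral_mul_fderiv_eq_neg_fderiv_mul_of_integrable]
  · simp only [ContinuousLinearMap.fderiv, integral_const_mul]
  · simp only [ContinuousLinearMap.fderiv]
    exact (continuous_const.mul hg.continuous).integrable_of_hasCompactSupport hc.mul_left
  · exact (ℓ.continuous.mul hg').integrable_of_hasCompactSupport (hc.fderiv_apply ℝ v).mul_left
  · exact (ℓ.continuous.mul hg.continuous).integrable_of_hasCompactSupport hc.mul_left
  · exact fun z _ => ℓ.differentiableAt
  · exact fun z _ => hg.differentiable (by simp) z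

theorem integral_fderiv_apply_eq_zero {g : Cn n → ℂ} (hg : ContDiff ℝ ∞ g)
    (hc : HasCompactSupport g) (v : Cn n) : ∫ z, fderiv ℝ g z v = 0 := by
  have hg' : Continuous fun z => fderiv ℝ g z v :=
    (hg.continuous_fderiv (by simp)).clm_apply continuous_const
  have h := integral_mul_fderiv_eq_neg_fderiv_mul_of_integrable (μ := (volume : Measure (Cn n)))
    (f := fun _ => (1 : ℂ)) (g := g) (v := v) (by simp)
    (by simpa using hg'.integrable_of_hasCompactSupport (hc.fderiv_apply ℝ v))
    (by simpa using hg.continuous.integrable_of_hasCompactSupport hc)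
    (fun z _ => differentiableAt_const _) (fun z _ => hg.differentiable (by simp) z)
  simpa using h

theorem integrable_fderiv_apply {g : Cn n → ℂ} (hg : ContDiff ℝ ∞ g)
    (hc : HasCompactSupport g) (v : Cn n) {a : Cn n → ℂ} (ha : Continuous a) :
    Integrable fun z => a z * fderiv ℝ g z v :=
  (ha.mul ((hg.continuous_fderiv (by simp)).clm_apply
    continuous_const)).integrable_of_hasCompactSupport (hc.fderiv_apply ℝ v).mul_left

theorem integral_dzbar_eq_zero {g : Cn n → ℂ} (hg : ContDiff ℝ ∞ g)
    (hc : HasCompactSupport g) (k : Fin n) : ∫ z, dzbar k g z = 0 := by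
  unfold dzbar
  rw [integral_div, integral_add, integral_const_mul, integral_fderiv_apply_eq_zero hg hc,
    integral_fderiv_apply_eq_zero hg hc]
  · simp
  · simpa using integrable_fderiv_apply hg hc (EuclideanSpace.single k 1)
      (continuous_const (y := (1 : ℂ)))
  · exact integrable_fderiv_apply hg hc _ continuous_const

/-- The derivative of `ℓ` is constant, so integrating by parts leaves multiples of `∫ g = 0`. -/
theorem integral_clm_mul_dz (ℓ : Cn n →L[ℝ] ℂ) {g : Cn n → ℂ} (hg : ContDiff ℝ ∞ g)
    (hc : HasCompactSupport g) (hg0 : ∫ z, g z = 0) (k : Fin n) : ∫ z, ℓ z * dz k g z = 0 := by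
  have : ∀ z, ℓ z * dz k g z = (ℓ z * fderiv ℝ g z (EuclideanSpace.single k 1) -
      Complex.I * (ℓ z * fderiv ℝ g z (EuclideanSpace.single k Complex.I))) / 2 := by
    intro z
    unfold dz
    ring
  simp only [this]
  rw [integral_div, integral_sub, integral_const_mul, integral_clm_mul_fderiv ℓ hg hc,
    integral_clm_mul_fderiv ℓ hg hc, hg0]
  · simp
  · exact integrable_fderiv_apply hg hc _ ℓ.continuous
  · exact (integrable_fderiv_apply hg hc _ ℓ.continuous).const_mul _

/-- Each Hessian entry is `dz` of some `dzbar` derivative, and the latter has integral zero; hence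
`integral_clm_mul_dz` applies entrywise. -/
theorem integral_clm_mul_hessianWedge (hn : 0 < n) (m : ℕ)
    (A : Fin n → Matrix (Fin n) (Fin n) ℂ) (ℓ : Cn n →L[ℝ] ℝ) {φ : Cn n → ℝ}
    (hφ : ContDiff ℝ ∞ φ) (hc : HasCompactSupport φ) :
    ∫ z, ℓ z * hessianWedge m A φ z = 0 := by
  obtain ⟨c, hcoef⟩ := exists_hessianWedge_eq hn m A
  let L : Cn n →L[ℝ] ℂ := Complex.ofRealCLM.comp ℓ
  have hψ : ContDiff ℝ ∞ fun z => (φ z : ℂ) := Complex.ofRealCLM.contDiff.comp hφ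
  have hψc : HasCompactSupport fun z => (φ z : ℂ) := hc.comp_left Complex.ofReal_zero
  have hzero : ∀ k l, ∫ z, L z * complexHessian φ z k l = 0 := fun k l =>
    integral_clm_mul_dz L (contDiff_dzbar hψ l)
      (hψc.of_isClosed_subset (isClosed_tsupport _) (tsupport_dzbar_subset _ l))
      (integral_dzbar_eq_zero hψ hψc l) k
  have hint : ∀ k l, Integrable fun z => L z * complexHessian φ z k l := fun k l =>
    (L.continuous.mul (contDiff_complexHessian hφ k l).continuous).integrable_of_hasCompactSupport
      (HasCompactSupport.mul_left
        (hc.of_isClosed_subset (isClosed_tsupport _) (tsupport_complexHessian_subset φ k l)))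
  have hre : ∀ z, ℓ z * hessianWedge m A φ z = (∑ σ, ∑ τ, c σ τ *
      (L z * complexHessian φ z (σ ⟨0, hn⟩) (τ ⟨0, hn⟩))).re := by
    intro z
    rw [hcoef, ← Complex.re_ofReal_mul, Finset.mul_sum]
    congr 1
    refine Finset.sum_congr rfl fun σ _ => ?_
    rw [Finset.mul_sum]
    refine Finset.sum_congr rfl fun τ _ => ?_
    change (ℓ z : ℂ) * _ = c σ τ * ((ℓ z : ℂ) * _)
    ring
  simp only [hre]
  have hint2 : ∀ σ ∈ (Finset.univ : Finset (Equiv.Perm (Fin n))), Integrable fun z => ∑ τ, c σ τ *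
      (L z * complexHessian φ z (σ ⟨0, hn⟩) ((τ : Equiv.Perm (Fin n)) ⟨0, hn⟩)) := fun σ _ =>
    integrable_finsetSum _ fun τ _ => (hint _ _).const_mul _
  have hcomm := integral_re (integrable_finsetSum _ hint2)
  simp only [RCLike.re_eq_complex_re] at hcomm
  rw [hcomm, integral_finsetSum _ hint2]
  simp only [integral_finsetSum _ fun τ _ => (hint _ _).const_mul _, integral_const_mul, hzero,
    mul_zero, Finset.sum_const_zero, Complex.zero_re]

theorem setAverage_clm_closedBall (ℓ : Cn n →L[ℝ] ℝ) (z : Cn n) {r : ℝ} (hr : 0 < r) :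
    ⨍ w in Metric.closedBall z r, ℓ w = ℓ z := by
  let B := Metric.closedBall z r
  have hB : MeasurableSet B := Metric.isClosed_closedBall.measurableSet
  have hi : IntegrableOn ℓ B :=
    ℓ.continuous.continuousOn.integrableOn_compact (isCompact_closedBall z r)
  have hfin : volume B ≠ ⊤ := measure_closedBall_lt_top.ne
  have hpos : 0 < volume.real B :=
    ENNReal.toReal_pos (Metric.measure_closedBall_pos volume z hr).ne' hfin
  -- The reflection `w ↦ z + z - w` preserves the ball and changes the sign of the integrand.
  have hodd : ∫ w in B, (ℓ w - ℓ z) = 0 := by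
    have h := integral_sub_left_eq_self (B.indicator fun w => ℓ w - ℓ z) volume (z + z)
    have hneg : ∀ w, B.indicator (fun w => ℓ w - ℓ z) (z + z - w) =
        -B.indicator (fun w => ℓ w - ℓ z) w := by
      intro w
      have hiff : z + z - w ∈ B ↔ w ∈ B := by
        simp only [B, Metric.mem_closedBall, dist_eq_norm]
        rw [show z + z - w - z = -(w - z) by abel, norm_neg]
      by_cases hw : w ∈ B
      · rw [Set.indicator_of_mem (hiff.2 hw), Set.indicator_of_mem hw, map_sub, map_add]
        ring
      · rw [Set.indicator_of_notMem (fun h => hw (hiff.1 h)), Set.indicator_of_notMem hw, neg_zero]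
    simp only [hneg, integral_neg, integral_indicator hB] at h
    linarith
  rw [integral_sub hi (integrableOn_const hfin), setIntegral_const, smul_eq_mul,
    sub_eq_zero] at hodd
  rw [setAverage_eq, hodd, smul_eq_mul, inv_mul_cancel_left₀ hpos.ne']

theorem isContMSubharmonicOn_clm (hn : 0 < n) (m : ℕ) (ℓ : Cn n →L[ℝ] ℝ) (U : Set (Cn n)) :
    IsContMSubharmonicOn m ℓ U where
  continuousOn := ℓ.continuous.continuousOn
  subharmonic z _ hr _ := (setAverage_clm_closedBall ℓ z hr).ge
  nonneg_current A _ _ hφ hc _ _ := (integral_clm_mul_hessianWedge hn m A ℓ hφ hc).ge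

theorem clm_mem_SHo (hn : 0 < n) (m : ℕ) (X : Set (Cn n)) (ℓ : Cn n →L[ℝ] ℝ) :
    (fun x : X => ℓ x) ∈ SHo m X :=
  ⟨Set.univ, ℓ, isOpen_univ, Set.subset_univ X, isContMSubharmonicOn_clm hn m ℓ _, fun _ => rfl⟩

theorem continuous_of_mem_SHo {m : ℕ} {X : Set (Cn n)} {f : X → ℝ} (hf : f ∈ SHo m X) :
    Continuous f := by
  obtain ⟨U, u, -, hXU, hu, hfu⟩ := hf
  rw [funext hfu]
  exact (hu.continuousOn.mono hXU).domRestrict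

theorem add_mem_SHo (hn : 0 < n) {m : ℕ} {X : Set (Cn n)} {f g : X → ℝ} (hf : f ∈ SHo m X)
    (hg : g ∈ SHo m X) : f + g ∈ SHo m X := by
  obtain ⟨U, u, hU, hXU, hu, hfu⟩ := hf
  obtain ⟨V, v, hV, hXV, hv, hgv⟩ := hg
  exact ⟨U ∩ V, u + v, hU.inter hV, Set.subset_inter hXU hXV,
    (hu.mono Set.inter_subset_left).add hn (hU.inter hV) (hv.mono Set.inter_subset_right),
    fun x => by simp [hfu, hgv]⟩

theorem smul_mem_SHo {m : ℕ} {X : Set (Cn n)} {f : X → ℝ} (hf : f ∈ SHo m X) {c : ℝ}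
    (hc : 0 ≤ c) : c • f ∈ SHo m X := by
  obtain ⟨U, u, hU, hXU, hu, hfu⟩ := hf
  exact ⟨U, c • u, hU, hXU, hu.smul hc, fun x => by simp [hfu]⟩

/-- The real inner product with `x - y` takes values at `x` and `y` that differ by `‖x - y‖²`. -/
theorem exists_mem_SHo_ne (hn : 0 < n) (m : ℕ) {X : Set (Cn n)} {x y : X} (hxy : x ≠ y) :
    ∃ f ∈ SHo m X, f x ≠ f y := by
  refine ⟨_, clm_mem_SHo hn m X (innerSL ℝ ((x : Cn n) - y)), fun h => hxy (Subtype.ext ?_)⟩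
  simp only [innerSL_apply_apply] at h
  rw [← sub_eq_zero, ← inner_sub_right, inner_self_eq_zero, sub_eq_zero] at h
  exact h

end Hessian

end MSH

theorem mainTheorem6 (n m : ℕ) (hm : 1 ≤ m) (hmn : m ≤ n) (X : Set (MSH.Cn n))
    (hX : IsCompact X) :
    IsLeast {E : Set X | IsClosed E ∧ ∀ z : X, ∃ μ ∈ MSH.jensenMeasures m X z, μ.support ⊆ E}
        (MSH.silovBoundary m X) ∧
      ∀ z : X, (MSH.boundaryJensenMeasures m X z).Nonempty := by
  have hn : 0 < n := lt_of_lt_of_le hm hmn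
  have : CompactSpace X := isCompact_iff_compactSpace.1 hX
  -- For this `S`, `representing` and `jensenMeasures` agree definitionally; the zero functional
  -- supplies `0 ∈ S`.
  have h := MSH.isLeast_closure_extremePoints (S := MSH.SHo m X)
    (fun _ hf => MSH.continuous_of_mem_SHo hf) (MSH.clm_mem_SHo hn m X 0)
    (fun _ hf _ hg => MSH.add_mem_SHo hn hf hg) (fun _ hc _ hf => MSH.smul_mem_SHo hf hc.le)
    (fun _ _ hxy => MSH.exists_mem_SHo_ne hn m hxy)
  refine ⟨h, fun z => ?_⟩
  obtain ⟨μ, hμ, hsupp⟩ := h.1.2 z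
  exact ⟨μ, hμ, hsupp⟩
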